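/- Let $d\in\mathbb N$, let $\mathbb T^d=(\mathbb R/\mathbb Z)^d$ with its Lebesgue measure $dx$ (of total mass one), and let $\mathcal P_2^L(\mathbb T^d\times\mathbb R)$ be the set of Borel probability measures $\mu$ on $\mathbb T^d\times\mathbb R$ whose first marginal is $dx$ and for which $\int|\theta|^2\,d\mu(x,\theta)<\infty$. For such $\mu$ let $(\mu^x)_{x\in\mathbb T^d}$ be a disintegration, i.e. a measurable family of probability measures on $\mathbb R$ with $\mu=\mu^x\,dx$. For probability measures $\rho,\sigma$ on $\mathbb R$ let $W_2(\rho,\sigma)^2=\inf_\gamma\int|\theta-\theta'|^2\,d\gamma(\theta,\theta')\in[0,\infty]$, where $\gamma$ runs over the couplings of $\rho$ and $\sigma$, and for $\mu,\nu\in\mathcal P_2^L(\mathbb T^d\times\mathbb R)$ let $$\mathrm W^L(\mu,\nu)=\Big(\int_{\mathbb T^d}W_2(\mu^x,\nu^x)^2\,dx\Big)^{1/2}.$$ 1. $\mathrm W^L$ is well defined: for all disintegrations of $\mu$ and $\nu$ the map $x\mapsto W_2(\mu^x,\nu^x)$ is measurable, and the integral does not depend on the chosen disintegrations. 2. $\mathrm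 W^L$ is a (finite) metric on $\mathcal P_2^L(\mathbb T^d\times\mathbb R)$. The metric space $(\mathcal P_2^L(\mathbb T^d\times\mathbb R),\mathrm W^L)$ is complete and separable; hence it is a Polish space. 3. Let $\mu$ and $\mu_n$ ($n\in\mathbb N$) be in $\mathcal P_2^L(\mathbb T^d\times\mathbb R)$, with any disintegrations. Then $\lim_{n\to\infty}\mathrm W^L(\mu_n,\mu)=0$ if and only if (i) $\lim_{n\to\infty}\int|\theta|^2\,d\mu_n=\int|\theta|^2\,d\mu$, and (ii) every subsequence of $(\mu_n)_n$ has a further subsequence $(\mu_{k_l})_l$ such that, for almost every $x\in\mathbb T^d$, $\mu_{k_l}^x\rightharpoonup\mu^x$ as $l\to\infty$, i.e. $\int f\,d\mu_{k_l}^x\to\int f\,d\mu^x$ for all bounded continuous $f:\mathbb R\to\mathbb R$. -/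

import Mathlib

open MeasureTheory ProbabilityTheory Filter Topology
open scoped ENNReal BoundedContinuousFunction

noncomputable section

namespace FibredWasserstein

/-- The `d`-dimensional unit torus `(ℝ / ℤ)^d`. Its `volume` is the product Lebesgue measure,
which has total mass one. -/
abbrev Torus (d : ℕ) : Type := UnitAddTorus (Fin d)

/-- The space of Borel probability measures `μ` on `𝕋^d × ℝ` whose first marginal is the Lebesgue
measure on `𝕋^d` and for which `∫ θ² dμ(x, θ)` is finite. -/
@[ext]
structure P2L (d : ℕ) where
  toMeasure : Measure (Torus d × ℝ)
  isProbabilityMeasure : IsProbabilityMeasure toMeasure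
  fst_eq : toMeasure.fst = volume
  integrable_sq : Integrable (fun p : Torus d × ℝ => |p.2| ^ 2) toMeasure

attribute [instance] P2L.isProbabilityMeasure

/-- The second moment `∫ |θ|² dμ(x, θ)`. -/
def P2L.secondMoment {d : ℕ} (μ : P2L d) : ℝ := ∫ p, |p.2| ^ 2 ∂μ.toMeasure

/-- The measurable family `x ↦ κ x` of probability measures on `ℝ` is a disintegration of `μ` with
respect to the Lebesgue measure: `μ = κ x dx`. -/
structure P2L.IsDisintegration {d : ℕ} (μ : P2L d) (κ : Kernel (Torus d) ℝ) : Prop where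
  isMarkovKernel : IsMarkovKernel κ
  eq_compProd : μ.toMeasure = (volume : Measure (Torus d)) ⊗ₘ κ

/-- A disintegration `x ↦ μ^x` of `μ`, namely Mathlib's conditional kernel. -/
def P2L.fibre {d : ℕ} (μ : P2L d) : Kernel (Torus d) ℝ := μ.toMeasure.condKernel

theorem P2L.isDisintegration_fibre {d : ℕ} (μ : P2L d) : μ.IsDisintegration μ.fibre where
  isMarkovKernel := by unfold P2L.fibre; infer_instance
  eq_compProd := by
    rw [← μ.fst_eq]
    exact (μ.toMeasure.disintegrate μ.toMeasure.condKernel).symm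

/-- Disintegrations are unique up to a Lebesgue null set. -/
theorem P2L.IsDisintegration.ae_eq_fibre {d : ℕ} {μ : P2L d} {κ : Kernel (Torus d) ℝ}
    (h : μ.IsDisintegration κ) : ∀ᵐ x, κ x = μ.fibre x := by
  have := h.isMarkovKernel
  have h2 := eq_condKernel_of_measure_eq_compProd (ρ := μ.toMeasure) κ
    (by rw [μ.fst_eq]; exact h.eq_compProd)
  rw [μ.fst_eq] at h2
  exact h2

/-- The couplings of two measures on `ℝ`. -/
def couplings (μ ν : Measure ℝ) : Set (Measure (ℝ × ℝ)) :=
  {γ | IsProbabilityMeasure γ ∧ γ.fst = μ ∧ γ.snd = ν}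

/-- The Wasserstein distance `W₂(μ, ν) = (inf_γ ∫ |θ - θ'|² dγ(θ, θ'))^{1/2} ∈ [0, ∞]`. -/
def W2 (μ ν : Measure ℝ) : ℝ≥0∞ :=
  (⨅ γ ∈ couplings μ ν, ∫⁻ p, ENNReal.ofReal (|p.1 - p.2| ^ 2) ∂γ) ^ (1 / 2 : ℝ)

/-- The fibred Wasserstein distance `W^L(μ, ν) = (∫ W₂(μ^x, ν^x)² dx)^{1/2}`, a priori in
`[0, ∞]`. -/
def WL {d : ℕ} (μ ν : P2L d) : ℝ≥0∞ :=
  (∫⁻ x : Torus d, W2 (μ.fibre x) (ν.fibre x) ^ 2) ^ (1 / 2 : ℝ)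

/-- Weak convergence of a sequence of measures on `ℝ`, tested against bounded continuous
functions. -/
def WeakConv (ν : ℕ → Measure ℝ) (ν₀ : Measure ℝ) : Prop :=
  ∀ f : ℝ →ᵇ ℝ, Tendsto (fun n => ∫ θ, f θ ∂(ν n)) atTop (𝓝 (∫ θ, f θ ∂ν₀))

end FibredWasserstein

end

/-!
On the real line the quadratic transport problem is solved by quantile functions: for probability
measures `μ`, `ν` on `ℝ` one has `W₂(μ, ν)² = ∫₀¹ |Q_μ - Q_ν|² du`, also when both sides are
infinite (`W2_sq_eq_lintegral_quantile`). The reason is that `|a - b|²` is the area of the square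
with side `[a, b)`. By Fubini the cost of a coupling `γ` is therefore an integral over `(s, t)` of
the masses `γ {θ ≤ min s t, max s t < θ'}` and of the same masses with `θ`, `θ'` exchanged. Such a
mass is at least the positive part of the difference of the distribution functions of the
marginals, and for the coupling by quantile functions it is at most that.

Quantile functions are jointly measurable in the fibre and the level, which gives the measurability
of `x ↦ W₂(κ x, η x)` for arbitrary Markov kernels. They also embed the space `P2L d`
isometrically into `L²(𝕋^d × (0, 1))` by `Φ : μ ↦ ((x, u) ↦ Q_{μ^x}(u))` (`P2L.toL2`,
`WL_eq_edist`), so the metric and its separability come from `L²`. For completeness one needs the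
image to be closed (`P2L.isClosed_range_toL2`). Let `g` be a limit of functions `Φ μₙ` in the image and let `ν`
be the law of `(x, u) ↦ (x, g (x, u))`. Fibrewise, `Φ μₙ` and `g` form a coupling of `μₙ` and `ν`,
hence `W^L(μₙ, ν) ≤ ‖Φ μₙ - g‖` tends to `0` and `g = Φ ν`.

Finally, `∫ |θ|² dμ` is the squared norm of `Φ μ`, and weak convergence of the fibres at almost
every `x` is the same as almost everywhere convergence of the functions `Φ μₙ`
(`P2L.ae_tendsto_toL2_iff`). The characterization of convergence is thus a statement about `L²`:
a convergent sequence has convergent norms and almost everywhere convergent subsequences, and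
conversely almost everywhere convergence with convergence of the norms implies convergence
(`tendsto_L2_of_ae_tendsto_of_tendsto_norm`).
-/

noncomputable section

namespace FibredWasserstein

/-! ### Quantile functions -/

/-- The uniform distribution on the open unit interval, as a measure on `ℝ`. -/
def uniform : Measure ℝ := volume.restrict (Set.Ioo 0 1)

instance : IsProbabilityMeasure uniform := ⟨by simp [uniform]⟩

instance : NullSingletonClass uniform := by unfold uniform; infer_instance

theorem ae_uniform_mem : ∀ᵐ u ∂uniform, u ∈ Set.Ioo (0 : ℝ) 1 :=
  ae_restrict_mem measurableSet_Ioo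

/-- The quantile function of `μ`, the generalized inverse of its distribution function. Outside
`(0, 1)`, where the infimum can be over an empty or unbounded set, it is set to `0`. -/
def quantile (μ : Measure ℝ) (u : ℝ) : ℝ :=
  open Classical in if u ∈ Set.Ioo (0 : ℝ) 1 then sInf {t | u ≤ cdf μ t} else 0

section Quantile

variable {μ ν : Measure ℝ} {u t : ℝ}

/-- The Galois connection between the quantile function and the distribution function. -/
theorem quantile_le_iff (hu : u ∈ Set.Ioo (0 : ℝ) 1) : quantile μ u ≤ t ↔ u ≤ cdf μ t := by
  have hbdd : BddBelow {t | u ≤ cdf μ t} := by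
    obtain ⟨a, ha⟩ := ((tendsto_cdf_atBot μ).eventually_lt_const hu.1).exists
    refine ⟨a, fun t ht => ?_⟩
    by_contra! hlt
    exact absurd (ht.trans (monotone_cdf μ hlt.le)) (not_le.2 ha)
  have hne : {t | u ≤ cdf μ t}.Nonempty := by
    obtain ⟨b, hb⟩ := ((tendsto_cdf_atTop μ).eventually_const_lt hu.2).exists
    exact ⟨b, hb.le⟩
  rw [quantile, if_pos hu]
  refine ⟨fun h => ?_, fun h => csInf_le hbdd h⟩
  have hright : ∀ s ∈ Set.Ioi t, u ≤ cdf μ s := by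
    intro s hs
    obtain ⟨r, hr, hrs⟩ := exists_lt_of_csInf_lt hne (h.trans_lt hs)
    exact le_trans hr (monotone_cdf μ hrs.le)
  refine ge_of_tendsto (((cdf μ).right_continuous t).mono_left
    (nhdsWithin_mono _ Set.Ioi_subset_Ici_self)) ?_
  filter_upwards [self_mem_nhdsWithin] with s hs using hright s hs

theorem lt_quantile_iff (hu : u ∈ Set.Ioo (0 : ℝ) 1) : t < quantile μ u ↔ cdf μ t < u := by
  rw [← not_le, quantile_le_iff hu, not_le]

theorem le_cdf_quantile (hu : u ∈ Set.Ioo (0 : ℝ) 1) : u ≤ cdf μ (quantile μ u) :=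
  (quantile_le_iff hu).1 le_rfl

theorem monotoneOn_quantile (μ : Measure ℝ) : MonotoneOn (quantile μ) (Set.Ioo 0 1) :=
  fun _ hu _ hv huv => (quantile_le_iff hu).2 (huv.trans (le_cdf_quantile hv))

/-- Quantile functions depend measurably on the measure and the argument jointly. -/
theorem measurable_quantile_kernel {α : Type*} [MeasurableSpace α] (κ : Kernel α ℝ)
    [IsMarkovKernel κ] : Measurable fun p : α × ℝ => quantile (κ p.1) p.2 := by
  have hS : MeasurableSet {p : α × ℝ | p.2 ∈ Set.Ioo (0 : ℝ) 1} :=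
    measurable_snd measurableSet_Ioo
  refine measurable_of_Iic fun t => ?_
  have : (fun p : α × ℝ => quantile (κ p.1) p.2) ⁻¹' Set.Iic t =
      ({p | p.2 ∈ Set.Ioo (0 : ℝ) 1} ∩ {p | p.2 ≤ (κ p.1).real (Set.Iic t)}) ∪
        ({p | p.2 ∈ Set.Ioo (0 : ℝ) 1}ᶜ ∩ {_p | 0 ≤ t}) := by
    ext p
    by_cases hp : p.2 ∈ Set.Ioo (0 : ℝ) 1
    · simp [-Set.mem_Ioo, hp, quantile_le_iff hp, cdf_eq_real]
    · simp [-Set.mem_Ioo, hp, quantile]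
  rw [this]
  refine (hS.inter (measurableSet_le measurable_snd ?_)).union (hS.compl.inter (.const _))
  exact ((κ.measurable_coe measurableSet_Iic).comp measurable_fst).ennreal_toReal

theorem measurable_quantile (μ : Measure ℝ) [IsProbabilityMeasure μ] : Measurable (quantile μ) :=
  (measurable_quantile_kernel (Kernel.const Unit μ)).comp
    (measurable_const.prodMk measurable_id : Measurable fun u : ℝ => ((), u))

/-- Inverse transform sampling: the quantile function carries the uniform distribution to `μ`. -/
theorem map_quantile (μ : Measure ℝ) [IsProbabilityMeasure μ] :
    uniform.map (quantile μ) = μ := by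
  have := Measure.isProbabilityMeasure_map (μ := uniform) (measurable_quantile μ).aemeasurable
  refine Measure.ext_of_Iic _ _ fun t => ?_
  rw [Measure.map_apply (measurable_quantile μ) measurableSet_Iic, ← ofReal_cdf μ t]
  have h : quantile μ ⁻¹' Set.Iic t =ᵐ[uniform] Set.Ioc 0 (cdf μ t) := by
    filter_upwards [ae_uniform_mem] with u hu
    exact propext ((quantile_le_iff hu).trans ⟨fun h => ⟨hu.1, h⟩, fun h => h.2⟩)
  rw [measure_congr h, uniform, Measure.restrict_congr_set Ioo_ae_eq_Ioc,
    Measure.restrict_apply measurableSet_Ioc, Set.Ioc_inter_Ioc, sup_idem,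
    min_eq_left (cdf_le_one μ t), Real.volume_Ioc, sub_zero]

end Quantile

/-! ### The one-dimensional Wasserstein distance -/

theorem measurableSet_le_and_lt {α : Type*} [MeasurableSpace α] {f g h k : α → ℝ}
    (hf : Measurable f) (hg : Measurable g) (hh : Measurable h) (hk : Measurable k) :
    MeasurableSet {x | f x ≤ g x ∧ h x < k x} :=
  (measurableSet_le hf hg).inter (measurableSet_lt hh hk)

/-- The square `[a, b)²`, which is empty unless `a < b`, is the set of those `(s, t)` with
`a ≤ min s t` and `max s t < b`. Hence `(a - b)²` is an integral of products of indicator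
functions of half-lines in `a` and in `b`, and the cost of a coupling is an integral of masses of
quadrants. -/
theorem lintegral_sq_eq_lintegral_quadrants (γ : Measure (ℝ × ℝ)) [IsProbabilityMeasure γ] :
    ∫⁻ p, ENNReal.ofReal (|p.1 - p.2| ^ 2) ∂γ =
      ∫⁻ q : ℝ × ℝ, (γ {p | p.1 ≤ min q.1 q.2 ∧ max q.1 q.2 < p.2} +
        γ {p | p.2 ≤ min q.1 q.2 ∧ max q.1 q.2 < p.1}) := by
  have hA : MeasurableSet {z : (ℝ × ℝ) × (ℝ × ℝ) |
      z.1.1 ≤ min z.2.1 z.2.2 ∧ max z.2.1 z.2.2 < z.1.2} :=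
    measurableSet_le_and_lt (by fun_prop) (by fun_prop) (by fun_prop) (by fun_prop)
  have hB : MeasurableSet {z : (ℝ × ℝ) × (ℝ × ℝ) |
      z.1.2 ≤ min z.2.1 z.2.2 ∧ max z.2.1 z.2.2 < z.1.1} :=
    measurableSet_le_and_lt (by fun_prop) (by fun_prop) (by fun_prop) (by fun_prop)
  have hsq : ∀ a b : ℝ, (volume : Measure (ℝ × ℝ))
      {q | a ≤ min q.1 q.2 ∧ max q.1 q.2 < b} = ENNReal.ofReal (b - a) ^ 2 := by
    intro a b
    have : {q : ℝ × ℝ | a ≤ min q.1 q.2 ∧ max q.1 q.2 < b} = Set.Ico a b ×ˢ Set.Ico a b := by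
      ext q
      simp only [Set.mem_ofPred_eq, le_min_iff, max_lt_iff, Set.mem_prod, Set.mem_Ico]
      tauto
    rw [this, Measure.volume_eq_prod, Measure.prod_prod, Real.volume_Ico, sq]
  have hpt : ∀ a b : ℝ, ENNReal.ofReal (|a - b| ^ 2) =
      ENNReal.ofReal (b - a) ^ 2 + ENNReal.ofReal (a - b) ^ 2 := by
    intro a b
    rw [ENNReal.ofReal_pow (abs_nonneg _)]
    rcases le_total a b with h | h
    · rw [abs_of_nonpos (by linarith), ENNReal.ofReal_of_nonpos (p := a - b) (by linarith)]
      simp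
    · rw [abs_of_nonneg (by linarith), ENNReal.ofReal_of_nonpos (p := b - a) (by linarith)]
      simp
  have h1 := (Measure.prod_apply (μ := γ) (ν := (volume : Measure (ℝ × ℝ))) hA).symm.trans
    (Measure.prod_apply_symm hA)
  have h2 := (Measure.prod_apply (μ := γ) (ν := (volume : Measure (ℝ × ℝ))) hB).symm.trans
    (Measure.prod_apply_symm hB)
  simp only [Set.preimage_ofPred_eq, hsq] at h1 h2
  simp only [hpt]
  rw [lintegral_add_left (by fun_prop), h1, h2, ← lintegral_add_left]
  exact measurable_measure_prodMk_right hA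

/-- A lower bound for the mass of a quadrant that only involves the marginals. -/
theorem measure_Iic_sub_le_quadrant (γ : Measure (ℝ × ℝ)) (s t : ℝ) :
    γ.fst (Set.Iic s) - γ.snd (Set.Iic t) ≤ γ {p | p.1 ≤ s ∧ t < p.2} := by
  rw [tsub_le_iff_right, Measure.fst_apply measurableSet_Iic, Measure.snd_apply measurableSet_Iic]
  refine (measure_mono fun p hp => ?_).trans (measure_union_le _ _)
  rcases lt_or_ge t p.2 with h | h
  · exact Or.inl ⟨hp, h⟩
  · exact Or.inr h

theorem measure_Iic_sub_le_quadrant_swap (γ : Measure (ℝ × ℝ)) (s t : ℝ) :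
    γ.snd (Set.Iic s) - γ.fst (Set.Iic t) ≤ γ {p | p.2 ≤ s ∧ t < p.1} := by
  rw [tsub_le_iff_right, Measure.fst_apply measurableSet_Iic, Measure.snd_apply measurableSet_Iic]
  refine (measure_mono fun p hp => ?_).trans (measure_union_le _ _)
  rcases lt_or_ge t p.1 with h | h
  · exact Or.inl ⟨hp, h⟩
  · exact Or.inr h

/-- For the coupling by quantile functions the lower bound `measure_Iic_sub_le_quadrant` is
attained. -/
theorem uniform_quadrant_le (μ ν : Measure ℝ) [IsProbabilityMeasure μ] [IsProbabilityMeasure ν]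
    (s t : ℝ) :
    uniform {u | quantile μ u ≤ s ∧ t < quantile ν u} ≤ μ (Set.Iic s) - ν (Set.Iic t) := by
  have h : uniform {u | quantile μ u ≤ s ∧ t < quantile ν u} ≤
      uniform (Set.Ioc (cdf ν t) (cdf μ s)) := by
    refine measure_mono_ae ?_
    filter_upwards [ae_uniform_mem] with u hu h
    exact ⟨(lt_quantile_iff hu).1 h.2, (quantile_le_iff hu).1 h.1⟩
  refine h.trans ((Measure.restrict_le_self _).trans ?_)
  rw [Real.volume_Ioc, ENNReal.ofReal_sub _ (cdf_nonneg _ _), ofReal_cdf, ofReal_cdf]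

theorem map_prodMk_mem_couplings {f g : ℝ → ℝ} (hf : Measurable f) (hg : Measurable g) :
    uniform.map (fun u => (f u, g u)) ∈ couplings (uniform.map f) (uniform.map g) :=
  ⟨Measure.isProbabilityMeasure_map (hf.prodMk hg).aemeasurable,
    Measure.fst_map_prodMk hg, Measure.snd_map_prodMk hf⟩

theorem W2_sq_eq_iInf (μ ν : Measure ℝ) :
    W2 μ ν ^ 2 = ⨅ γ ∈ couplings μ ν, ∫⁻ p, ENNReal.ofReal (|p.1 - p.2| ^ 2) ∂γ := by
  rw [W2, ← ENNReal.rpow_natCast, ← ENNReal.rpow_mul]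
  norm_num

theorem lintegral_map_prodMk_sq {f g : ℝ → ℝ} (hf : Measurable f) (hg : Measurable g) :
    ∫⁻ p, ENNReal.ofReal (|p.1 - p.2| ^ 2) ∂uniform.map (fun u => (f u, g u)) =
      ∫⁻ u, ‖f u - g u‖ₑ ^ 2 ∂uniform := by
  rw [lintegral_map (by fun_prop) (hf.prodMk hg)]
  simp only [ENNReal.ofReal_pow (abs_nonneg _), Real.enorm_eq_ofReal_abs]

/-- Any two random variables on the unit interval bound the Wasserstein distance of their laws. -/
theorem W2_sq_map_le {f g : ℝ → ℝ} (hf : Measurable f) (hg : Measurable g) :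
    W2 (uniform.map f) (uniform.map g) ^ 2 ≤ ∫⁻ u, ‖f u - g u‖ₑ ^ 2 ∂uniform := by
  rw [W2_sq_eq_iInf, ← lintegral_map_prodMk_sq hf hg]
  exact iInf₂_le _ (map_prodMk_mem_couplings hf hg)

/-- In dimension one the coupling by quantile functions is optimal. No moments are assumed; both
sides can be infinite. -/
theorem W2_sq_eq_lintegral_quantile (μ ν : Measure ℝ) [IsProbabilityMeasure μ]
    [IsProbabilityMeasure ν] :
    W2 μ ν ^ 2 = ∫⁻ u, ‖quantile μ u - quantile ν u‖ₑ ^ 2 ∂uniform := by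
  have hμ := measurable_quantile μ
  have hν := measurable_quantile ν
  refine le_antisymm ?_ ?_
  · simpa only [map_quantile] using W2_sq_map_le hμ hν
  · rw [W2_sq_eq_iInf]
    refine le_iInf₂ fun γ hγ => ?_
    obtain ⟨hp, rfl, rfl⟩ := hγ
    have := (map_prodMk_mem_couplings hμ hν).1
    rw [← lintegral_map_prodMk_sq hμ hν, lintegral_sq_eq_lintegral_quadrants,
      lintegral_sq_eq_lintegral_quadrants]
    refine lintegral_mono fun q => add_le_add ?_ ?_
    · rw [Measure.map_apply (hμ.prodMk hν) (measurableSet_le_and_lt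
        (by fun_prop) (by fun_prop) (by fun_prop) (by fun_prop))]
      exact (uniform_quadrant_le γ.fst γ.snd _ _).trans (measure_Iic_sub_le_quadrant γ _ _)
    · rw [Measure.map_apply (hμ.prodMk hν) (measurableSet_le_and_lt
        (by fun_prop) (by fun_prop) (by fun_prop) (by fun_prop))]
      exact (uniform_quadrant_le γ.snd γ.fst _ _).trans (measure_Iic_sub_le_quadrant_swap γ _ _)

theorem W2_eq_lintegral_quantile (μ ν : Measure ℝ) [IsProbabilityMeasure μ]
    [IsProbabilityMeasure ν] :
    W2 μ ν = (∫⁻ u, ‖quantile μ u - quantile ν u‖ₑ ^ 2 ∂uniform) ^ (1 / 2 : ℝ) := by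
  rw [← W2_sq_eq_lintegral_quantile, ← ENNReal.rpow_natCast, ← ENNReal.rpow_mul]
  norm_num

/-! ### Weak convergence and quantile functions -/

/-- Weak convergence implies convergence of the quantile functions at every point of continuity
of the limit. -/
theorem WeakConv.tendsto_quantile {ν : ℕ → Measure ℝ} {ν₀ : Measure ℝ}
    [∀ n, IsProbabilityMeasure (ν n)] [IsProbabilityMeasure ν₀] (h : WeakConv ν ν₀) {u : ℝ}
    (hu : u ∈ Set.Ioo (0 : ℝ) 1) (hc : ContinuousWithinAt (quantile ν₀) (Set.Ioo 0 1) u) :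
    Tendsto (fun n => quantile (ν n) u) atTop (𝓝 (quantile ν₀ u)) := by
  have hlim : Tendsto (β := ProbabilityMeasure ℝ) (fun n => ⟨ν n, inferInstance⟩) atTop
      (𝓝 ⟨ν₀, inferInstance⟩) :=
    ProbabilityMeasure.tendsto_iff_forall_integral_tendsto.2 h
  refine tendsto_order.2 ⟨fun a ha => ?_, fun b hb => ?_⟩
  · have h1 : limsup (fun n => ν n (Set.Iic a)) atTop < ENNReal.ofReal u := by
      refine (ProbabilityMeasure.limsup_measure_closed_le_of_tendsto hlim
        isClosed_Iic).trans_lt ?_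
      change ν₀ (Set.Iic a) < _
      rw [← ofReal_cdf]
      exact (ENNReal.ofReal_lt_ofReal_iff hu.1).2 ((lt_quantile_iff hu).1 ha)
    filter_upwards [eventually_lt_of_limsup_lt h1] with n hn
    rw [← ofReal_cdf, ENNReal.ofReal_lt_ofReal_iff hu.1] at hn
    exact (lt_quantile_iff hu).2 hn
  · -- continuity provides a level `v > u` whose quantile is still below `b`
    have hev : ∀ᶠ v in 𝓝[>] u, quantile ν₀ v < b ∧ v ∈ Set.Ioo (0 : ℝ) 1 ∧ u < v := by
      have hmem : Set.Ioo (0 : ℝ) 1 ∈ 𝓝[>] u := mem_nhdsWithin_of_mem_nhds (Ioo_mem_nhds hu.1 hu.2)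
      have hle : 𝓝[>] u ≤ 𝓝[Set.Ioo 0 1] u := le_inf nhdsWithin_le_nhds (le_principal_iff.2 hmem)
      filter_upwards [(hc.mono_left hle).eventually_lt_const hb, hmem, self_mem_nhdsWithin]
        with v h1 h2 h3 using ⟨h1, h2, h3⟩
    obtain ⟨v, hvb, hv, huv⟩ := hev.exists
    obtain ⟨c, hvc, hcb⟩ := exists_between hvb
    have h1 : ENNReal.ofReal u < liminf (fun n => ν n (Set.Iio c)) atTop := by
      refine lt_of_lt_of_le ?_ (ProbabilityMeasure.le_liminf_measure_open_of_tendsto hlim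
        isOpen_Iio)
      change _ < ν₀ (Set.Iio c)
      calc ENNReal.ofReal u < ENNReal.ofReal v := (ENNReal.ofReal_lt_ofReal_iff hv.1).2 huv
        _ ≤ ENNReal.ofReal (cdf ν₀ (quantile ν₀ v)) :=
          ENNReal.ofReal_le_ofReal (le_cdf_quantile hv)
        _ ≤ ν₀ (Set.Iio c) := by
          rw [ofReal_cdf]
          exact measure_mono fun x hx => lt_of_le_of_lt hx hvc
    filter_upwards [eventually_lt_of_lt_liminf h1] with n hn
    refine lt_of_le_of_lt ((quantile_le_iff hu).2 ?_) hcb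
    have h2 := hn.trans_le (measure_mono Set.Iio_subset_Iic_self)
    rw [← ofReal_cdf] at h2
    exact (ENNReal.ofReal_lt_ofReal_iff_of_nonneg hu.1.le).1 h2 |>.le

theorem WeakConv.ae_tendsto_quantile {ν : ℕ → Measure ℝ} {ν₀ : Measure ℝ}
    [∀ n, IsProbabilityMeasure (ν n)] [IsProbabilityMeasure ν₀] (h : WeakConv ν ν₀) :
    ∀ᵐ u ∂uniform, Tendsto (fun n => quantile (ν n) u) atTop (𝓝 (quantile ν₀ u)) := by
  have hcount := (monotoneOn_quantile ν₀).countable_not_continuousWithinAt.ae_notMem uniform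
  filter_upwards [ae_uniform_mem, hcount] with u hu hc
  exact h.tendsto_quantile hu (by_contra fun h' => hc ⟨hu, h'⟩)

/-- Almost everywhere convergence of the quantile functions implies weak convergence. -/
theorem weakConv_of_ae_tendsto_quantile {ν : ℕ → Measure ℝ} {ν₀ : Measure ℝ}
    [∀ n, IsProbabilityMeasure (ν n)] [IsProbabilityMeasure ν₀]
    (h : ∀ᵐ u ∂uniform, Tendsto (fun n => quantile (ν n) u) atTop (𝓝 (quantile ν₀ u))) :
    WeakConv ν ν₀ := by
  intro f
  have key : ∀ (ρ : Measure ℝ) [IsProbabilityMeasure ρ],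
      ∫ θ, f θ ∂ρ = ∫ u, f (quantile ρ u) ∂uniform := by
    intro ρ _
    conv_lhs => rw [← map_quantile ρ]
    exact integral_map (measurable_quantile ρ).aemeasurable
      f.continuous.aestronglyMeasurable
  simp only [key]
  refine tendsto_integral_of_dominated_convergence (fun _ => ‖f‖)
    (fun n => (f.continuous.measurable.comp (measurable_quantile _)).aestronglyMeasurable)
    (integrable_const _) (fun n => .of_forall fun u => f.norm_coe_le_norm _) ?_
  filter_upwards [h] with u hu using (f.continuous.tendsto _).comp hu

/-! ### Quantile representation of fibred measures -/

instance : IsProbabilityMeasure (volume : Measure UnitAddCircle) := ⟨UnitAddCircle.measure_univ⟩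

/-- The reference measure on `𝕋^d × ℝ`, the product of the Lebesgue measure and the uniform
distribution. The space `P2L d` is identified with a closed subset of its `L²` space. -/
abbrev refMeasure (d : ℕ) : Measure (Torus d × ℝ) :=
  (volume : Measure (Torus d)).prod uniform

variable {d : ℕ}

/-- The kernel that maps `x` to the law of `f (x, ·)` under the uniform distribution. -/
def lawKernel {f : Torus d × ℝ → ℝ} (hf : Measurable f) : Kernel (Torus d) ℝ where
  toFun x := uniform.map fun u => f (x, u)
  measurable' := by
    refine Measure.measurable_of_measurable_coe _ fun s hs => ?_
    simp only [Measure.map_apply (f := fun u => f (_, u)) (hf.comp measurable_prodMk_left) hs]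
    exact measurable_measure_prodMk_left (hf hs)

instance {f : Torus d × ℝ → ℝ} (hf : Measurable f) : IsMarkovKernel (lawKernel hf) :=
  ⟨fun _ => Measure.isProbabilityMeasure_map (hf.comp measurable_prodMk_left).aemeasurable⟩

theorem volume_compProd_lawKernel {f : Torus d × ℝ → ℝ} (hf : Measurable f) :
    (volume : Measure (Torus d)) ⊗ₘ lawKernel hf =
      (refMeasure d).map fun p => (p.1, f p) := by
  have hF : Measurable fun p : Torus d × ℝ => (p.1, f p) := measurable_fst.prodMk hf
  ext s hs
  rw [Measure.compProd_apply hs, Measure.map_apply hF hs, Measure.prod_apply (hF hs)]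
  refine lintegral_congr fun x => ?_
  exact Measure.map_apply (hf.comp measurable_prodMk_left) (measurable_prodMk_left hs)

/-- The law of `(x, u) ↦ (x, f (x, u))` as an element of `P2L d`. -/
def P2L.ofFun {f : Torus d × ℝ → ℝ} (hf : Measurable f) (hf2 : MemLp f 2 (refMeasure d)) :
    P2L d where
  toMeasure := (refMeasure d).map fun p => (p.1, f p)
  isProbabilityMeasure :=
    Measure.isProbabilityMeasure_map (measurable_fst.prodMk hf).aemeasurable
  fst_eq := by
    rw [Measure.fst_map_prodMk hf]
    exact measurePreserving_fst.map_eq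
  integrable_sq := by
    rw [integrable_map_measure (by fun_prop) (measurable_fst.prodMk hf).aemeasurable]
    simpa only [Function.comp_def, sq_abs] using hf2.integrable_sq

theorem P2L.isDisintegration_ofFun {f : Torus d × ℝ → ℝ} (hf : Measurable f)
    (hf2 : MemLp f 2 (refMeasure d)) : (P2L.ofFun hf hf2).IsDisintegration (lawKernel hf) :=
  ⟨inferInstance, (volume_compProd_lawKernel hf).symm⟩

instance (μ : P2L d) : IsMarkovKernel μ.fibre := μ.isDisintegration_fibre.isMarkovKernel

/-- The quantile functions of the fibres of `μ`, as a function of both variables. -/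
def P2L.fibreQuantile (μ : P2L d) (p : Torus d × ℝ) : ℝ := quantile (μ.fibre p.1) p.2

theorem P2L.measurable_fibreQuantile (μ : P2L d) : Measurable μ.fibreQuantile :=
  measurable_quantile_kernel μ.fibre

theorem P2L.lawKernel_fibreQuantile (μ : P2L d) :
    lawKernel μ.measurable_fibreQuantile = μ.fibre := by
  ext1 x
  exact map_quantile (μ.fibre x)

theorem P2L.measurePreserving_fibreQuantile (μ : P2L d) :
    MeasurePreserving (fun p => (p.1, μ.fibreQuantile p)) (refMeasure d) μ.toMeasure where
  measurable := measurable_fst.prodMk μ.measurable_fibreQuantile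
  map_eq := by
    rw [← volume_compProd_lawKernel μ.measurable_fibreQuantile, μ.lawKernel_fibreQuantile]
    exact μ.isDisintegration_fibre.eq_compProd.symm

theorem P2L.memLp_fibreQuantile (μ : P2L d) : MemLp μ.fibreQuantile 2 (refMeasure d) := by
  rw [memLp_two_iff_integrable_sq μ.measurable_fibreQuantile.aestronglyMeasurable]
  have h := μ.measurePreserving_fibreQuantile.integrable_comp_of_integrable μ.integrable_sq
  simpa only [Function.comp_def, sq_abs] using h

/-- The embedding of `P2L d` into an `L²` space by the quantile functions of the fibres. -/
def P2L.toL2 (μ : P2L d) : Lp ℝ 2 (refMeasure d) := μ.memLp_fibreQuantile.toLp μ.fibreQuantile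

theorem P2L.coeFn_toL2 (μ : P2L d) : μ.toL2 =ᵐ[refMeasure d] μ.fibreQuantile :=
  μ.memLp_fibreQuantile.coeFn_toLp

theorem P2L.norm_toL2_sq (μ : P2L d) : ‖μ.toL2‖ ^ 2 = μ.secondMoment := by
  rw [← real_inner_self_eq_norm_sq, L2.inner_def, P2L.secondMoment,
    ← μ.measurePreserving_fibreQuantile.map_eq,
    integral_map μ.measurePreserving_fibreQuantile.aemeasurable (by fun_prop)]
  refine integral_congr_ae ?_
  filter_upwards [μ.coeFn_toL2] with p hp
  rw [hp, real_inner_self_eq_norm_sq, Real.norm_eq_abs]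

/-! ### The fibred Wasserstein distance as an `L²` distance -/

theorem measurable_W2_kernel (κ η : Kernel (Torus d) ℝ) [IsMarkovKernel κ] [IsMarkovKernel η] :
    Measurable fun x => W2 (κ x) (η x) := by
  simp only [W2_eq_lintegral_quantile]
  refine Measurable.pow_const (Measurable.lintegral_prod_right' (f := fun p : Torus d × ℝ =>
    ‖quantile (κ p.1) p.2 - quantile (η p.1) p.2‖ₑ ^ 2) ?_) _
  exact ((measurable_quantile_kernel κ).sub (measurable_quantile_kernel η)).enorm.pow_const 2

theorem WL_eq_of_isDisintegration {μ ν : P2L d} {κ η : Kernel (Torus d) ℝ}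
    (hκ : μ.IsDisintegration κ) (hη : ν.IsDisintegration η) :
    WL μ ν = (∫⁻ x, W2 (κ x) (η x) ^ 2) ^ (1 / 2 : ℝ) := by
  rw [WL]
  congr 1
  refine lintegral_congr_ae ?_
  filter_upwards [hκ.ae_eq_fibre, hη.ae_eq_fibre] with x h1 h2
  rw [h1, h2]

theorem eLpNorm_two_refMeasure {f : Torus d × ℝ → ℝ} (hf : Measurable f) :
    eLpNorm f 2 (refMeasure d) =
      (∫⁻ x : Torus d, ∫⁻ u, ‖f (x, u)‖ₑ ^ 2 ∂uniform) ^ (1 / 2 : ℝ) := by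
  rw [eLpNorm_eq_lintegral_rpow_enorm_toReal (by simp) (by simp)]
  simp only [ENNReal.toReal_ofNat, ENNReal.rpow_ofNat]
  rw [lintegral_prod _ (by fun_prop)]

theorem WL_eq_edist (μ ν : P2L d) : WL μ ν = edist μ.toL2 ν.toL2 := by
  rw [P2L.toL2, P2L.toL2, Lp.edist_toLp_toLp,
    eLpNorm_two_refMeasure (μ.measurable_fibreQuantile.sub ν.measurable_fibreQuantile), WL]
  simp only [W2_sq_eq_lintegral_quantile, Pi.sub_apply, P2L.fibreQuantile]

/-- Fibrewise, a function `f` and the quantile functions of `μ` form a coupling. Hence passing from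
an element of `L²` to its law does not increase the distance to the quantile functions. -/
theorem WL_ofFun_le (μ : P2L d) {f : Torus d × ℝ → ℝ} (hf : Measurable f)
    (hf2 : MemLp f 2 (refMeasure d)) :
    WL μ (P2L.ofFun hf hf2) ≤ eLpNorm (μ.fibreQuantile - f) 2 (refMeasure d) := by
  have h := μ.measurable_fibreQuantile
  rw [eLpNorm_two_refMeasure (h.sub hf),
    WL_eq_of_isDisintegration μ.isDisintegration_fibre (P2L.isDisintegration_ofFun hf hf2)]
  refine ENNReal.rpow_le_rpow (lintegral_mono fun x => ?_) (by norm_num)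
  rw [← μ.lawKernel_fibreQuantile]
  exact W2_sq_map_le (h.comp measurable_prodMk_left) (hf.comp measurable_prodMk_left)

theorem P2L.toL2_injective : Function.Injective (P2L.toL2 (d := d)) := by
  intro μ ν h
  refine P2L.ext ?_
  rw [← μ.measurePreserving_fibreQuantile.map_eq, ← ν.measurePreserving_fibreQuantile.map_eq]
  refine Measure.map_congr ?_
  filter_upwards [μ.coeFn_toL2, ν.coeFn_toL2] with p h1 h2
  rw [← h1, ← h2, h]

theorem P2L.isClosed_range_toL2 : IsClosed (Set.range (P2L.toL2 (d := d))) := by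
  refine isClosed_of_closure_subset fun g hg => ?_
  obtain ⟨F, hF, hlim⟩ := mem_closure_iff_seq_limit.1 hg
  choose μ hμ using hF
  obtain rfl : (fun n => (μ n).toL2) = F := funext hμ
  -- the limit `g` is the image of its own law `ν`, by `WL_ofFun_le`
  let ν := P2L.ofFun (Lp.stronglyMeasurable g).measurable (Lp.memLp g)
  have hle : ∀ n, edist (μ n).toL2 ν.toL2 ≤ edist (μ n).toL2 g := by
    intro n
    rw [← WL_eq_edist, Lp.edist_def]
    refine (WL_ofFun_le _ _ _).trans (eLpNorm_congr_ae ?_).le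
    filter_upwards [(μ n).coeFn_toL2] with p hp
    simp only [Pi.sub_apply, hp]
  refine ⟨ν, tendsto_nhds_unique ?_ hlim⟩
  rw [tendsto_iff_edist_tendsto_0] at hlim ⊢
  exact tendsto_of_tendsto_of_tendsto_of_le_of_le tendsto_const_nhds hlim (fun _ => zero_le) hle

theorem exists_metricSpace_P2L (d : ℕ) : ∃ m : MetricSpace (P2L d),
    (∀ μ ν : P2L d, WL μ ν = ENNReal.ofReal (dist μ ν)) ∧ CompleteSpace (P2L d) ∧
      TopologicalSpace.SeparableSpace (P2L d) ∧ PolishSpace (P2L d) := by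
  let m : MetricSpace (P2L d) := MetricSpace.induced P2L.toL2 P2L.toL2_injective inferInstance
  have hiso : Isometry (P2L.toL2 (d := d)) := Isometry.of_dist_eq fun _ _ => rfl
  have : Fact ((2 : ℝ≥0∞) ≠ ∞) := ⟨ENNReal.ofNat_ne_top⟩
  have := isSeparable_of_sigmaFinite (refMeasure d)
  have hpolish : PolishSpace (P2L d) :=
    Topology.IsClosedEmbedding.polishSpace ⟨hiso.isEmbedding, P2L.isClosed_range_toL2⟩
  refine ⟨m, fun μ ν => ?_, ?_, inferInstance, hpolish⟩
  · exact (WL_eq_edist μ ν).trans ((hiso.edist_eq μ ν).trans (edist_dist μ ν))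
  · exact hiso.isUniformInducing.completeSpace P2L.isClosed_range_toL2.isComplete

/-! ### Convergence -/

/-- The Radon–Riesz property for almost everywhere convergence: in `L²`, almost everywhere
convergence together with convergence of the norms implies convergence. By Fatou's lemma the norms
of `F n + F₀` converge to `2 ‖F₀‖`, and the parallelogram law applies. -/
theorem tendsto_L2_of_ae_tendsto_of_tendsto_norm {α E : Type*} [MeasurableSpace α] {m : Measure α}
    [NormedAddCommGroup E] [InnerProductSpace ℝ E] {F : ℕ → Lp E 2 m} {F₀ : Lp E 2 m}
    (hae : ∀ᵐ a ∂m, Tendsto (fun n => F n a) atTop (𝓝 (F₀ a)))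
    (hnorm : Tendsto (fun n => ‖F n‖) atTop (𝓝 ‖F₀‖)) : Tendsto F atTop (𝓝 F₀) := by
  have hsum : Tendsto (fun n => ‖F n + F₀‖) atTop (𝓝 (‖F₀‖ + ‖F₀‖)) := by
    refine tendsto_order.2 ⟨fun c hc => ?_, fun c hc => ?_⟩
    · have hfatou : eLpNorm (F₀ + F₀ : Lp E 2 m) 2 m ≤
          liminf (fun n => eLpNorm (F n + F₀ : Lp E 2 m) 2 m) atTop := by
        refine Lp.eLpNorm_lim_le_liminf_eLpNorm (fun n => Lp.aestronglyMeasurable _) _ ?_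
        filter_upwards [hae, Lp.coeFn_add F₀ F₀, ae_all_iff.2 fun n => Lp.coeFn_add (F n) F₀]
          with a ha h0 hn
        simp only [h0, hn, Pi.add_apply]
        exact ha.add_const _
      have hF₀ : ‖F₀ + F₀‖ = ‖F₀‖ + ‖F₀‖ := by
        rw [← two_smul ℝ, norm_smul, Real.norm_two, two_mul]
      rcases lt_or_ge c 0 with h0 | h0
      · exact .of_forall fun n => h0.trans_le (norm_nonneg _)
      have hlt : ENNReal.ofReal c < eLpNorm (F₀ + F₀ : Lp E 2 m) 2 m := by
        rw [← Lp.enorm_def, ← ofReal_norm, hF₀]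
        exact (ENNReal.ofReal_lt_ofReal_iff_of_nonneg h0).2 hc
      filter_upwards [eventually_lt_of_lt_liminf (hlt.trans_le hfatou)] with n hn
      rw [← Lp.enorm_def, ← ofReal_norm] at hn
      exact (ENNReal.ofReal_lt_ofReal_iff_of_nonneg h0).1 hn
    · filter_upwards [(hnorm.add_const ‖F₀‖).eventually_lt_const hc] with n hn
      exact (norm_add_le _ _).trans_lt hn
  have hdiff : ∀ n, ‖F n - F₀‖ ^ 2 = 2 * (‖F n‖ ^ 2 + ‖F₀‖ ^ 2) - ‖F n + F₀‖ ^ 2 := by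
    intro n
    have := parallelogram_law_with_norm ℝ (F n) F₀
    simp only [sq]
    linarith
  have hsq : Tendsto (fun n => ‖F n - F₀‖ ^ 2) atTop (𝓝 0) := by
    simp only [hdiff]
    have := (((hnorm.pow 2).add_const (‖F₀‖ ^ 2)).const_mul 2).sub (hsum.pow 2)
    convert this using 2
    ring
  rw [tendsto_iff_norm_sub_tendsto_zero]
  simpa using hsq.sqrt

theorem P2L.tendsto_norm_toL2_iff {μ : ℕ → P2L d} {μ₀ : P2L d} :
    Tendsto (fun n => ‖(μ n).toL2‖) atTop (𝓝 ‖μ₀.toL2‖) ↔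
      Tendsto (fun n => (μ n).secondMoment) atTop (𝓝 μ₀.secondMoment) := by
  simp only [← P2L.norm_toL2_sq]
  refine ⟨fun h => h.pow 2, fun h => ?_⟩
  simpa using h.sqrt

/-- Almost everywhere convergence of the embedded functions is weak convergence of almost every
fibre. -/
theorem P2L.ae_tendsto_toL2_iff {μ : ℕ → P2L d} {μ₀ : P2L d} :
    (∀ᵐ p ∂refMeasure d, Tendsto (fun n => (μ n).toL2 p) atTop (𝓝 (μ₀.toL2 p))) ↔
      ∀ᵐ x, WeakConv (fun n => (μ n).fibre x) (μ₀.fibre x) := by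
  have hcongr : (∀ᵐ p ∂refMeasure d, Tendsto (fun n => (μ n).toL2 p) atTop (𝓝 (μ₀.toL2 p))) ↔
      ∀ᵐ p ∂refMeasure d,
        Tendsto (fun n => (μ n).fibreQuantile p) atTop (𝓝 (μ₀.fibreQuantile p)) := by
    refine eventually_congr ?_
    filter_upwards [μ₀.coeFn_toL2, ae_all_iff.2 fun n => (μ n).coeFn_toL2] with p h0 hn
    simp only [h0, hn]
  have hmeas : MeasurableSet {p : Torus d × ℝ |
      Tendsto (fun n => (μ n).fibreQuantile p) atTop (𝓝 (μ₀.fibreQuantile p))} :=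
    measurableSet_tendsto_fun (fun n => (μ n).measurable_fibreQuantile)
      μ₀.measurable_fibreQuantile
  rw [hcongr, Measure.ae_prod_iff_ae_ae hmeas]
  exact eventually_congr (.of_forall fun x =>
    ⟨fun h => weakConv_of_ae_tendsto_quantile h, fun h => h.ae_tendsto_quantile⟩)

theorem tendsto_WL_iff (μ : ℕ → P2L d) (μ₀ : P2L d) :
    Tendsto (fun n => WL (μ n) μ₀) atTop (𝓝 0) ↔
      Tendsto (fun n => (μ n).secondMoment) atTop (𝓝 μ₀.secondMoment) ∧
      ∀ φ : ℕ → ℕ, StrictMono φ → ∃ ψ : ℕ → ℕ, StrictMono ψ ∧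
        ∀ᵐ x, WeakConv (fun l => (μ (φ (ψ l))).fibre x) (μ₀.fibre x) := by
  simp only [WL_eq_edist, ← tendsto_iff_edist_tendsto_0, ← P2L.tendsto_norm_toL2_iff,
    ← P2L.ae_tendsto_toL2_iff]
  refine ⟨fun h => ⟨h.norm, fun φ hφ => ?_⟩, fun ⟨hnorm, hsub⟩ => ?_⟩
  · exact (tendstoInMeasure_of_tendsto_Lp (h.comp hφ.tendsto_atTop)).exists_seq_tendsto_ae
  · refine tendsto_of_subseq_tendsto fun ns hns => ?_
    -- `ns` only tends to infinity; the hypothesis needs a strictly increasing subsequence of it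
    obtain ⟨ρ, -, hρ⟩ := strictMono_subseq_of_tendsto_atTop hns
    obtain ⟨ψ, hψ, hae⟩ := hsub _ hρ
    exact ⟨fun l => ρ (ψ l), tendsto_L2_of_ae_tendsto_of_tendsto_norm hae
      (hnorm.comp (hρ.comp hψ).tendsto_atTop)⟩

end FibredWasserstein

end

theorem mainTheorem9 (d : ℕ) :
    -- `W^L` is well defined: the integrand is measurable, whatever disintegrations are used, and
    -- the value does not depend on them
    (∀ (μ ν : FibredWasserstein.P2L d) (κ η : Kernel (FibredWasserstein.Torus d) ℝ),
      μ.IsDisintegration κ → ν.IsDisintegration η →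
        Measurable (fun x => FibredWasserstein.W2 (κ x) (η x)) ∧
        FibredWasserstein.WL μ ν = (∫⁻ x, FibredWasserstein.W2 (κ x) (η x) ^ 2) ^ (1 / 2 : ℝ)) ∧
    -- `W^L` is a finite metric, and the metric space is complete, separable and Polish
    (∃ m : MetricSpace (FibredWasserstein.P2L d),
      (∀ μ ν : FibredWasserstein.P2L d,
        FibredWasserstein.WL μ ν = ENNReal.ofReal (dist μ ν)) ∧
      CompleteSpace (FibredWasserstein.P2L d) ∧
      TopologicalSpace.SeparableSpace (FibredWasserstein.P2L d) ∧
      PolishSpace (FibredWasserstein.P2L d)) ∧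
    -- characterization of convergence
    (∀ (μ : ℕ → FibredWasserstein.P2L d) (μ₀ : FibredWasserstein.P2L d)
      (κ : ℕ → Kernel (FibredWasserstein.Torus d) ℝ) (κ₀ : Kernel (FibredWasserstein.Torus d) ℝ),
      (∀ n, (μ n).IsDisintegration (κ n)) → μ₀.IsDisintegration κ₀ →
        (Tendsto (fun n => FibredWasserstein.WL (μ n) μ₀) atTop (𝓝 0) ↔
          Tendsto (fun n => (μ n).secondMoment) atTop (𝓝 μ₀.secondMoment) ∧
          ∀ φ : ℕ → ℕ, StrictMono φ → ∃ ψ : ℕ → ℕ, StrictMono ψ ∧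
            ∀ᵐ x, FibredWasserstein.WeakConv (fun l => κ (φ (ψ l)) x) (κ₀ x))) := by
  refine ⟨fun μ ν κ η hκ hη => ?_, FibredWasserstein.exists_metricSpace_P2L d,
    fun μ μ₀ κ κ₀ hκ hκ₀ => ?_⟩
  · have := hκ.isMarkovKernel
    have := hη.isMarkovKernel
    exact ⟨FibredWasserstein.measurable_W2_kernel κ η,
      FibredWasserstein.WL_eq_of_isDisintegration hκ hη⟩
  · have hall : ∀ᵐ x, κ₀ x = μ₀.fibre x ∧ ∀ n, κ n x = (μ n).fibre x :=
      hκ₀.ae_eq_fibre.and (ae_all_iff.2 fun n => (hκ n).ae_eq_fibre)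
    rw [FibredWasserstein.tendsto_WL_iff]
    refine and_congr_right fun _ => forall₂_congr fun φ _ => exists_congr fun ψ =>
      and_congr_right fun _ => eventually_congr ?_
    filter_upwards [hall] with x hx
    simp only [hx.1, hx.2]
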